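/- Let $m > 1$ and $n \geq 0$ be integers, let $\mathbb{R}^m$ and $\mathbb{R}^n$ carry their Euclidean norms $|\cdot|$, and let $h : \mathbb{R}^m \to \mathbb{R}^n$ be a map. Call $h$ \emph{distance equality preserving} if, for all $x, y, z, w \in \mathbb{R}^m$, $|x-y| = |z-w|$ implies $|h(x)-h(y)| = |h(z)-h(w)|$. Call $h$ a \emph{similarity map} if there is a constant $\lambda \geq 0$ such that $|h(x)-h(y)| = \lambda\,|x-y|$ for all $x, y \in \mathbb{R}^m$ (the value $\lambda = 0$ is allowed, so constant maps are similarity maps). Then $h$ is continuous and distance equality preserving if and only if $h$ is a similarity map. -/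

import Mathlib

/-- A map is distance equality preserving if `d(x,y) = d(z,w)` implies
`d(h x, h y) = d(h z, h w)`. -/
def DistanceEqualityPreserving {X Y : Type*} [Dist X] [Dist Y] (h : X → Y) : Prop :=
  ∀ x y z w : X, dist x y = dist z w → dist (h x) (h y) = dist (h z) (h w)

/-- A similarity map multiplies all distances by a constant `c ≥ 0`; the value `c = 0` is
allowed, so that constant maps are similarity maps. -/
def IsSimilarityMap {X Y : Type*} [Dist X] [Dist Y] (h : X → Y) : Prop :=
  ∃ c : ℝ, 0 ≤ c ∧ ∀ x y : X, dist (h x) (h y) = c * dist x y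

/-!
A similarity is plainly continuous and distance equality preserving. For the converse, let `h` be
continuous and distance equality preserving between finite-dimensional Euclidean spaces, the source
of dimension at least two. By polarization, the norm of `(h a - h b) - (h c - h d)` depends only on
the mutual distances of `a, b, c, d`
(`DistanceEqualityPreserving.norm_sub_sub_sub_eq`). Thus the defect
`‖(h (y + v) - h v) - (h y - h 0)‖` is unchanged when `y` and `v` are moved by one linear isometry
or when all four points are translated.

*Recurrence.* The maps `y ↦ h (y + k • w) - h (k • w)`, `k : ℕ`, are uniformly bounded and
equicontinuous on bounded sets, so two of them are uniformly close on a given ball. After a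
translation this says that the defect of `(y, N • w)` is small for some `N ≥ 1`, uniformly for `y`
in the ball (`DistanceEqualityPreserving.exists_nsmul_defect_lt`).

*Isosceles triangles.* By rotation, the defect of `(y, v)` is then small for every `v` of length
`N * ‖w‖`. In dimension at least two, `w` is the difference of two vectors of that length, so the
defect of `(y, w)` is small as well, hence zero
(`DistanceEqualityPreserving.map_add_sub_map`).

So `h - h 0` is additive and continuous, hence linear, and a linear map whose norms `‖h y - h 0‖`
depend only on `‖y‖` scales all norms by the same factor.
-/

section InnerProductSpaces

variable {E F : Type*} [NormedAddCommGroup E] [InnerProductSpace ℝ E]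
  [NormedAddCommGroup F] [InnerProductSpace ℝ F]

/-- Polarization: the norm of a second difference is determined by mutual distances. -/
theorem norm_sub_sub_sub_sq (a b c d : F) :
    ‖(a - b) - (c - d)‖ ^ 2 =
      dist a b ^ 2 + dist c d ^ 2 + dist a c ^ 2 + dist b d ^ 2 - dist a d ^ 2 - dist b c ^ 2 := by
  simp only [dist_eq_norm, ← real_inner_self_eq_norm_sq, inner_sub_left, inner_sub_right]
  rw [real_inner_comm a b, real_inner_comm a c, real_inner_comm a d, real_inner_comm b c,
    real_inner_comm b d, real_inner_comm c d]
  ring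

theorem DistanceEqualityPreserving.norm_sub_sub_sub_eq {X : Type*} [Dist X] {h : X → F}
    (hh : DistanceEqualityPreserving h) {a b c d a' b' c' d' : X}
    (hab : dist a b = dist a' b') (hcd : dist c d = dist c' d')
    (hac : dist a c = dist a' c') (hbd : dist b d = dist b' d')
    (had : dist a d = dist a' d') (hbc : dist b c = dist b' c') :
    ‖(h a - h b) - (h c - h d)‖ = ‖(h a' - h b') - (h c' - h d')‖ := by
  rw [← sq_eq_sq₀ (norm_nonneg _) (norm_nonneg _), norm_sub_sub_sub_sq, norm_sub_sub_sub_sq,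
    hh _ _ _ _ hab, hh _ _ _ _ hcd, hh _ _ _ _ hac, hh _ _ _ _ hbd, hh _ _ _ _ had,
    hh _ _ _ _ hbc]

/-- Recurrence: among the multiples of `w` there is one along which translation changes the
increments `h y - h 0` arbitrarily little, uniformly for `y` in a ball. -/
theorem DistanceEqualityPreserving.exists_nsmul_defect_lt [FiniteDimensional ℝ E]
    [FiniteDimensional ℝ F] {h : E → F} (hh : DistanceEqualityPreserving h) (hc : Continuous h)
    (w : E) (r : ℝ) {ε : ℝ} (hε : 0 < ε) :
    ∃ N : ℕ, 1 ≤ N ∧ ∀ y : E, ‖y‖ ≤ r →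
      ‖(h (y + N • w) - h (N • w)) - (h y - h 0)‖ < ε := by
  obtain ⟨δ, hδ, hδε⟩ := Metric.continuousAt_iff.1 (hc.continuousAt (x := 0)) (ε / 3)
    (by positivity)
  have huc : ∀ y z, dist y z < δ → dist (h y) (h z) < ε / 3 := by
    intro y z hyz
    rw [hh y z (y - z) 0 (by simp [dist_eq_norm])]
    exact hδε (by simpa [dist_eq_norm] using hyz)
  -- Two terms of the sequence that are close on a finite `δ`-net are close on the whole ball.
  obtain ⟨t, htf, htc⟩ := Metric.totallyBounded_iff.1
    (isCompact_closedBall (0 : E) r).totallyBounded δ hδ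
  let : Fintype t := htf.fintype
  let f : ℕ → t → F := fun k y => h (y + k • w) - h (k • w)
  have hf : ∀ k, f k ∈ Metric.closedBall (0 : t → F) (∑ y : t, ‖h y - h 0‖) := by
    intro k
    rw [mem_closedBall_zero_iff, pi_norm_le_iff_of_nonneg (by positivity)]
    intro y
    have : ‖f k y‖ = ‖h y - h 0‖ := by
      simpa [dist_eq_norm] using hh (y + k • w) (k • w) y 0 (by simp [dist_eq_norm])
    rw [this]
    exact Finset.single_le_sum (f := fun y : t => ‖h y - h 0‖) (fun _ _ => norm_nonneg _)
      (Finset.mem_univ y)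
  obtain ⟨_, _, φ, hφ, hlim⟩ := (isCompact_closedBall _ _).tendsto_subseq hf
  obtain ⟨K, hK⟩ := Metric.cauchySeq_iff.1 hlim.cauchySeq (ε / 3) (by positivity)
  have hlt : φ K < φ (K + 1) := hφ (Nat.lt_succ_self K)
  refine ⟨φ (K + 1) - φ K, by omega, fun y hy => ?_⟩
  obtain ⟨z, hz, hyz⟩ : ∃ z ∈ t, dist y z < δ := by
    simpa using htc (mem_closedBall_zero_iff.2 hy)
  have hclose : dist (f (φ (K + 1)) ⟨z, hz⟩) (f (φ K) ⟨z, hz⟩) < ε / 3 :=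
    (dist_le_pi_dist _ _ _).trans_lt (hK (K + 1) (by omega) K le_rfl)
  have hw : φ (K + 1) • w = (φ (K + 1) - φ K) • w + φ K • w := by
    rw [← add_nsmul, Nat.sub_add_cancel hlt.le]
  have hshift : ‖(h (z + (φ (K + 1) - φ K) • w) - h ((φ (K + 1) - φ K) • w)) - (h z - h 0)‖
      = dist (f (φ (K + 1)) ⟨z, hz⟩) (f (φ K) ⟨z, hz⟩) := by
    rw [dist_eq_norm]
    simp only [f, hw]
    apply hh.norm_sub_sub_sub_eq <;> simp only [dist_eq_norm] <;> congr 1 <;> abel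
  set u := (φ (K + 1) - φ K) • w
  have h1 : ‖h (y + u) - h (z + u)‖ < ε / 3 := by
    rw [← dist_eq_norm]; exact huc _ _ (by simpa using hyz)
  have h2 : ‖h z - h y‖ < ε / 3 := by
    rw [← dist_eq_norm]; exact huc _ _ (by rwa [dist_comm])
  calc ‖(h (y + u) - h u) - (h y - h 0)‖
      = ‖(h (y + u) - h (z + u)) + ((h (z + u) - h u) - (h z - h 0)) + (h z - h y)‖ := by
        congr 1; abel
    _ ≤ _ := norm_add₃_le
    _ < ε := by linarith

/-- In dimension at least two, every vector `w` is the base of an isosceles triangle whose legs have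
any prescribed length not less than `‖w‖`. -/
theorem exists_norm_eq_norm_sub_eq [FiniteDimensional ℝ E] (hE : 1 < Module.finrank ℝ E)
    (w : E) {s : ℝ} (hs : ‖w‖ ≤ s) : ∃ v : E, ‖v‖ = s ∧ ‖v - w‖ = s := by
  obtain ⟨p, hp, hp0⟩ : ∃ p ∈ (ℝ ∙ w)ᗮ, p ≠ 0 := by
    apply Submodule.exists_mem_ne_zero_of_ne_bot
    intro hbot
    have h1 := (ℝ ∙ w).finrank_add_finrank_orthogonal
    have h2 : Module.finrank ℝ (ℝ ∙ w) ≤ 1 := by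
      simpa using finrank_span_le_card (R := ℝ) ({w} : Set E)
    rw [hbot, finrank_bot] at h1
    omega
  have hwp : inner ℝ w p = 0 := Submodule.mem_orthogonal_singleton_iff_inner_right.1 hp
  have hw0 := norm_nonneg w
  have hq0 : 0 ≤ s ^ 2 - (‖w‖ / 2) ^ 2 := by nlinarith
  set q : E := (√(s ^ 2 - (‖w‖ / 2) ^ 2) / ‖p‖) • p with hq
  have hqn : ‖q‖ ^ 2 = s ^ 2 - (‖w‖ / 2) ^ 2 := by
    have : ‖p‖ ≠ 0 := norm_ne_zero_iff.2 hp0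
    rw [hq, norm_smul, mul_pow, Real.norm_eq_abs, sq_abs, div_pow, Real.sq_sqrt hq0]
    field_simp
  have hwq : inner ℝ w q = 0 := by rw [hq, inner_smul_right, hwp, mul_zero]
  have hn : ∀ a : ℝ, a ^ 2 = 1 / 4 → ‖a • w + q‖ = s := by
    intro a ha
    rw [← sq_eq_sq₀ (norm_nonneg _) (hw0.trans hs), norm_add_sq_real, inner_smul_left, hwq,
      norm_smul, mul_pow, Real.norm_eq_abs, sq_abs, ha, hqn]
    ring
  refine ⟨(1 / 2 : ℝ) • w + q, hn _ (by norm_num), ?_⟩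
  rw [show (1 / 2 : ℝ) • w + q - w = (-(1 / 2) : ℝ) • w + q by module]
  exact hn _ (by norm_num)

/-- Increments of a continuous distance equality preserving map are translation invariant. -/
theorem DistanceEqualityPreserving.map_add_sub_map [FiniteDimensional ℝ E]
    [FiniteDimensional ℝ F] (hE : 1 < Module.finrank ℝ E) {h : E → F}
    (hh : DistanceEqualityPreserving h) (hc : Continuous h) (y w : E) :
    h (y + w) - h w = h y - h 0 := by
  rw [← sub_eq_zero, ← norm_le_zero_iff]
  refine le_of_forall_pos_le_add fun ε hε => ?_
  obtain ⟨N, hN, hNy⟩ := hh.exists_nsmul_defect_lt hc w ‖y‖ (half_pos hε)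
  have hrot : ∀ v, ‖v‖ = ‖N • w‖ → ‖(h (y + v) - h v) - (h y - h 0)‖ < ε / 2 := by
    intro v hv
    -- The reflection exchanging `v` and `N • w` carries the pair `(y, v)` to `(R y, N • w)`.
    let R : E ≃ₗᵢ[ℝ] E := (ℝ ∙ (v - N • w))ᗮ.reflection
    have hR : R v = N • w := Submodule.reflection_sub hv
    have heq : ‖(h (y + v) - h v) - (h y - h 0)‖ =
        ‖(h (R y + N • w) - h (N • w)) - (h (R y) - h 0)‖ := by
      rw [← hR, ← map_add]
      apply hh.norm_sub_sub_sub_eq <;>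
        simp only [dist_eq_norm, sub_zero, ← map_sub, R.norm_map]
    rw [heq]
    exact hNy _ (R.norm_map y).le
  obtain ⟨v, hv, hvw⟩ := exists_norm_eq_norm_sub_eq hE w (s := ‖N • w‖) (by
    rw [← Nat.cast_smul_eq_nsmul ℝ, norm_smul, Real.norm_natCast]
    exact le_mul_of_one_le_left (norm_nonneg w) (by exact_mod_cast hN))
  have hshift : ‖(h (y + w) - h w) - (h y - h 0)‖ =
      ‖(h (y + v) - h v) - (h (y + (v - w)) - h (v - w))‖ := by
    apply hh.norm_sub_sub_sub_eq <;> simp only [dist_eq_norm] <;> congr 1 <;> abel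
  have h1 := hrot v hv
  have h2 := hrot (v - w) hvw
  rw [hshift, zero_add]
  calc ‖(h (y + v) - h v) - (h (y + (v - w)) - h (v - w))‖
      = ‖((h (y + v) - h v) - (h y - h 0)) -
          ((h (y + (v - w)) - h (v - w)) - (h y - h 0))‖ := by congr 1; abel
    _ ≤ _ := norm_sub_le _ _
    _ ≤ ε := by linarith

theorem DistanceEqualityPreserving.isSimilarityMap [FiniteDimensional ℝ E]
    [FiniteDimensional ℝ F] (hE : 1 < Module.finrank ℝ E) {h : E → F}
    (hh : DistanceEqualityPreserving h) (hc : Continuous h) : IsSimilarityMap h := by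
  let f : E →+ F := AddMonoidHom.mk' (fun y => h y - h 0) fun y w => by
    rw [← hh.map_add_sub_map hE hc y w]; abel
  have hlin : ∀ (c : ℝ) (y : E), f (c • y) = c • f y :=
    map_real_smul f (hc.sub continuous_const)
  have : Nontrivial E := Module.nontrivial_of_finrank_pos (R := ℝ) (by omega)
  obtain ⟨e, he⟩ := exists_norm_eq E zero_le_one
  refine ⟨‖f e‖, norm_nonneg _, fun x y => ?_⟩
  rw [hh x y (dist x y • e) 0 (by simp [norm_smul, he]), dist_eq_norm]
  change ‖f (dist x y • e)‖ = _
  rw [hlin, norm_smul, Real.norm_of_nonneg dist_nonneg, mul_comm]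

end InnerProductSpaces

theorem IsSimilarityMap.continuous {X Y : Type*} [PseudoMetricSpace X] [PseudoMetricSpace Y]
    {h : X → Y} (hh : IsSimilarityMap h) : Continuous h := by
  obtain ⟨c, hc, hd⟩ := hh
  exact (LipschitzWith.of_dist_le_mul (K := ⟨c, hc⟩) fun x y => (hd x y).le).continuous

theorem IsSimilarityMap.distanceEqualityPreserving {X Y : Type*} [Dist X] [Dist Y]
    {h : X → Y} (hh : IsSimilarityMap h) : DistanceEqualityPreserving h := by
  obtain ⟨c, -, hd⟩ := hh
  intro x y z w hxy
  rw [hd, hd, hxy]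

theorem mainTheorem1 (m n : ℕ) (hm : 1 < m)
    (h : EuclideanSpace ℝ (Fin m) → EuclideanSpace ℝ (Fin n)) :
    (Continuous h ∧ DistanceEqualityPreserving h) ↔ IsSimilarityMap h :=
  ⟨fun ⟨hc, hh⟩ => hh.isSimilarityMap (by simpa using hm) hc,
    fun hh => ⟨hh.continuous, hh.distanceEqualityPreserving⟩⟩
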